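/- Throughout, all probability measures are finitely supported and $\mathbb N=\{1,2,\ldots\}$. For a metric space $(X,d_X)$ let $\mathscr P_X$ be the set of (finitely supported) probability measures on $X$, let $\delta_x$ be the point mass at $x$, and for $p\in[1,\infty)$ and $\mu,\nu\in\mathscr P_X$ let $$W_p(\mu,\nu)=\inf_{\pi}\Big(\int_{X\times X}d_X(x,y)^p\,d\pi(x,y)\Big)^{1/p},$$ where the infimum is over all couplings $\pi\in\mathscr P_{X\times X}$ of $\mu$ and $\nu$. For $p\in[1,\infty)$, an integer $n\in\mathbb N$ and a matrix $A=(a_{ij})\in M_n(\mathbb R)$ with nonnegative entries, let $\gamma_+(A,d_X^p)\in[0,\infty]$ be the infimum over those $\gamma\in(0,\infty]$ for which every $x_1,\ldots,x_n,y_1,\ldots,y_n\in X$ satisfy $$\frac1{n^2}\sum_{i=1}^n\sum_{j=1}^n d_X(x_i,y_j)^p\le\frac{\gamma}{n}\sum_{i=1}^n\sum_{j=1}^n a_{ij}\,d_X(x_i,y_j)^p$$ (so $\gamma_+(A,d_X^p)=\infty$ if no finite $\gamma$ has this property). Theorem. There exists a universal constant $c\in(1,\infty)$ with the following property. Let $p,K,\Gamma\in[1,\infty)$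 and let $(X,d_X)$ be a metric space that is $W_p$ barycentric with constant $\Gamma$ and $p$-barycentric with constant $K$ with respect to the same barycenter map, i.e., there exists $\mathfrak B:\mathscr P_X\to X$ such that $\mathfrak B(\delta_x)=x$ for every $x\in X$, $$d_X(\mathfrak B(\mu),\mathfrak B(\nu))\le\Gamma\, W_p(\mu,\nu)\qquad\text{for all }\mu,\nu\in\mathscr P_X,$$ and $$d_X(x,\mathfrak B(\mu))^p+\frac1{K^p}\int_X d_X(\mathfrak B(\mu),y)^p\,d\mu(y)\le\int_X d_X(x,y)^p\,d\mu(y)\qquad\text{for all }x\in X,\ \mu\in\mathscr P_X.$$ Then for every $n,t\in\mathbb N$ every symmetric stochastic matrix $A\in M_n(\mathbb R)$ satisfies $$\gamma_+\Big(\frac1t\sum_{s=1}^tA^s,\,d_X^p\Big)\le(c\,\Gamma K)^p\max\Big\{1,\frac{\gamma_+(A,d_X^p)}{t}\Big\}.$$ -/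

import Mathlib

open scoped ENNReal
open Convexity (StdSimplex)

noncomputable section

namespace BarycentricCalculus

/-- The set of (finitely supported) probability measures on `X`. -/
abbrev ProbMeas (X : Type*) := StdSimplex ℝ X

/-- The point mass at `x`. -/
abbrev pointMass {X : Type*} (x : X) : ProbMeas X := StdSimplex.single x

/-- The integral of a real-valued function against a finitely supported probability measure. -/
def integral {X : Type*} (μ : ProbMeas X) (f : X → ℝ) : ℝ :=
  μ.weights.sum fun x w => w * f x

/-- `Π(μ, ν)`: the probability measures on `X × X` whose two marginals are `μ` and `ν`. -/
def couplings {X : Type*} (μ ν : ProbMeas X) : Set (ProbMeas (X × X)) :=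
  {π | π.map Prod.fst = μ ∧ π.map Prod.snd = ν}

/-- The Wasserstein `p` distance, an infimum over couplings of nonnegative real numbers.
(The set of couplings contains the product measure, so this is never an empty infimum.) -/
def wasserstein {X : Type*} [MetricSpace X] (p : ℝ) (μ ν : ProbMeas X) : ℝ :=
  sInf ((fun π : ProbMeas (X × X) => (integral π fun z => dist z.1 z.2 ^ p) ^ (1 / p)) ''
    couplings μ ν)

/-- The map `B` witnesses that `X` is `W_p` barycentric with constant `Γ`: it is a barycenter map
(it sends every point mass to its atom) and is `Γ`-Lipschitz for the Wasserstein `p` distance. -/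
def IsWpBarycenterMap {X : Type*} [MetricSpace X] (B : ProbMeas X → X) (p Γ : ℝ) : Prop :=
  (∀ x : X, B (pointMass x) = x) ∧
    ∀ μ ν : ProbMeas X, dist (B μ) (B ν) ≤ Γ * wasserstein p μ ν

/-- The map `B` witnesses that `X` is `p`-barycentric with constant `K`. -/
def IsPBarycenterMap {X : Type*} [MetricSpace X] (B : ProbMeas X → X) (p K : ℝ) : Prop :=
  ∀ (x : X) (μ : ProbMeas X),
    dist x (B μ) ^ p + 1 / K ^ p * integral μ (fun y => dist (B μ) y ^ p) ≤
      integral μ (fun y => dist x y ^ p)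

/-- Symmetric stochastic matrices: symmetric, with nonnegative entries and rows summing to `1`. -/
def IsSymmStochastic {n : ℕ} (A : Matrix (Fin n) (Fin n) ℝ) : Prop :=
  A.IsSymm ∧ (∀ i j, 0 ≤ A i j) ∧ ∀ i, ∑ j, A i j = 1

/-- `γ₊(A, d_X^p)`, for a matrix `A` with nonnegative entries: the infimum over those
`γ ∈ (0, ∞]` such that all `x₁, …, xₙ, y₁, …, yₙ ∈ X` satisfy
`(1 / n²) ∑ᵢⱼ d(xᵢ, yⱼ)^p ≤ (γ / n) ∑ᵢⱼ aᵢⱼ d(xᵢ, yⱼ)^p`. The sums are nonnegative real numbers;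
they are embedded in `[0, ∞]` in order to multiply by `γ`. The infimum is `∞` if no finite `γ`
is admissible. -/
def gammaPlus (X : Type*) [MetricSpace X] {n : ℕ} (A : Matrix (Fin n) (Fin n) ℝ) (p : ℝ) :
    ℝ≥0∞ :=
  sInf {γ : ℝ≥0∞ | 0 < γ ∧ ∀ x y : Fin n → X,
    ENNReal.ofReal (1 / (n : ℝ) ^ 2 * ∑ i, ∑ j, dist (x i) (y j) ^ p) ≤
      γ / (n : ℝ≥0∞) * ENNReal.ofReal (∑ i, ∑ j, A i j * dist (x i) (y j) ^ p)}

/-- The Cesàro average `(1 / t) ∑_{s = 1}^t A ^ s`. -/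
def cesaro {n : ℕ} (A : Matrix (Fin n) (Fin n) ℝ) (t : ℕ) : Matrix (Fin n) (Fin n) ℝ :=
  (1 / (t : ℝ)) • ∑ s ∈ Finset.Icc 1 t, A ^ s

end BarycentricCalculus

end

/-!
The proof iterates the barycenter map along the Markov chain. Given `x, y : Fin n → X`, let
`z 0 = y` and let `z (r + 1) i` be the barycenter of the law of `z r j`, where `j` is distributed
according to the `i`-th row of `A`. The `p`-barycentric inequality, applied at the point `x i` and
averaged against the doubly stochastic matrices `A ^ u`, telescopes to (`barycentricIter_energy_le`)
```
∑ᵢ d(xᵢ, z r i)^p + K^(-p) ∑_{q < r} ∑ᵢⱼ aᵢⱼ d(z (q+1) i, z q j)^p ≤ ∑ᵢⱼ (A^r)ᵢⱼ d(xᵢ, yⱼ)^p.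
```
The right-hand sides, averaged over `1 ≤ r ≤ t`, give the energy `F` of the Cesàro average `C`. So
typically `z r` is close to `x`, while the energy of the consecutive pair `z (r+1), z r` with
respect to `A` is at most of order `K^p F / t`. The definition of `γ₊(A, d^p)` turns the latter
into a bound on the unweighted sum of `d(z (r+1) i, z r j)^p`. A triangle inequality through
`z (r+1)` and `z r`, and one use of `C` to pass from `x` to `y`
(`sum_dist_rpow_le_of_doublyStochastic`), then bounds the unweighted sum of `d(xᵢ, yⱼ)^p`.
Summing these bounds over all pairs `r ≤ s < t` avoids selecting a particular `r`.

The argument uses only the `p`-barycentric inequality, so it yields the constant `(10 K)^p`, which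
is at most `(10 Γ K)^p`.
-/

open scoped ENNReal
open Convexity (StdSimplex)
open Finset

namespace BarycentricCalculus

/-! ### Iterated barycenters along a stochastic matrix -/

section Iteration

variable {ι X : Type*} [Fintype ι] [DecidableEq ι] {A C : Matrix ι ι ℝ}

/-- The `i`-th row of a doubly stochastic matrix, as a probability measure on the index set. -/
noncomputable def rowMeas (hA : A ∈ doublyStochastic ℝ ι) (i : ι) : ProbMeas ι where
  weights := Finsupp.equivFunOnFinite.symm (A i)
  nonneg j := nonneg_of_mem_doublyStochastic hA
  total := by
    rw [Finsupp.sum_fintype _ _ fun _ => rfl]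
    exact sum_row_of_mem_doublyStochastic hA i

theorem integral_map_rowMeas (hA : A ∈ doublyStochastic ℝ ι) (i : ι) (x : ι → X) (f : X → ℝ) :
    integral ((rowMeas hA i).map x) f = ∑ j, A i j * f (x j) := by
  unfold integral
  rw [StdSimplex.weights_map, Finsupp.sum_mapDomain_index (by simp) (by intros; ring),
    Finsupp.sum_fintype _ _ (by simp)]
  rfl

/-- The nonlinear analogue of the action of `A` on `X`-valued functions: the average of `x` against
the `i`-th row of `A` is replaced by a barycenter. `barycentricIter B hA y r` is its
`r`-th iterate at `y`. -/
noncomputable def barycentricIter (B : ProbMeas X → X) (hA : A ∈ doublyStochastic ℝ ι)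
    (y : ι → X) : ℕ → ι → X
  | 0 => y
  | r + 1 => fun i => B ((rowMeas hA i).map (barycentricIter B hA y r))

/-- The `p`-energy, with respect to `A`, of the `r`-th step of the barycentric iteration. -/
noncomputable def stepEnergy [MetricSpace X] (B : ProbMeas X → X) (hA : A ∈ doublyStochastic ℝ ι)
    (y : ι → X) (p : ℝ) (r : ℕ) : ℝ :=
  ∑ i, ∑ j, A i j * dist (barycentricIter B hA y (r + 1) i) (barycentricIter B hA y r j) ^ p

variable [MetricSpace X] {B : ProbMeas X → X} {p K : ℝ}

theorem stepEnergy_nonneg (hA : A ∈ doublyStochastic ℝ ι) (y : ι → X) (r : ℕ) :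
    0 ≤ stepEnergy B hA y p r :=
  sum_nonneg fun _ _ => sum_nonneg fun _ _ =>
    mul_nonneg (nonneg_of_mem_doublyStochastic hA) (Real.rpow_nonneg dist_nonneg _)

/-- One step of the telescoping: the `p`-barycentric inequality for the rows of `A`, averaged
against another doubly stochastic matrix `C`. -/
theorem sum_mul_dist_barycentricIter_succ_le (hB : IsPBarycenterMap B p K)
    (hA : A ∈ doublyStochastic ℝ ι) (hC : C ∈ doublyStochastic ℝ ι) (x y : ι → X) (r : ℕ) :
    ∑ i, ∑ j, C i j * dist (x i) (barycentricIter B hA y (r + 1) j) ^ p +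
        1 / K ^ p * stepEnergy B hA y p r ≤
      ∑ i, ∑ j, (C * A) i j * dist (x i) (barycentricIter B hA y r j) ^ p := by
  set z := barycentricIter B hA y with hz
  have hpt (i j : ι) : dist (x i) (z (r + 1) j) ^ p +
      1 / K ^ p * ∑ k, A j k * dist (z (r + 1) j) (z r k) ^ p ≤
        ∑ k, A j k * dist (x i) (z r k) ^ p := by
    have h := hB (x i) ((rowMeas hA j).map (z r))
    rwa [integral_map_rowMeas, integral_map_rowMeas] at h
  have hsum : ∑ i, ∑ j, C i j * (dist (x i) (z (r + 1) j) ^ p +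
      1 / K ^ p * ∑ k, A j k * dist (z (r + 1) j) (z r k) ^ p) ≤
        ∑ i, ∑ j, C i j * ∑ k, A j k * dist (x i) (z r k) ^ p := by
    gcongr with i _ j _
    · exact nonneg_of_mem_doublyStochastic hC
    · exact hpt i j
  have hcol : ∑ i, ∑ j, C i j * (1 / K ^ p * ∑ k, A j k * dist (z (r + 1) j) (z r k) ^ p) =
      1 / K ^ p * stepEnergy B hA y p r := by
    rw [sum_comm, stepEnergy, mul_sum]
    refine sum_congr rfl fun j _ => ?_
    rw [← sum_mul, sum_col_of_mem_doublyStochastic hC, one_mul]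
  have hmul : ∑ i, ∑ j, C i j * ∑ k, A j k * dist (x i) (z r k) ^ p =
      ∑ i, ∑ k, (C * A) i k * dist (x i) (z r k) ^ p := by
    refine sum_congr rfl fun i _ => ?_
    simp only [Matrix.mul_apply, sum_mul, mul_sum, mul_assoc]
    exact sum_comm
  simp only [mul_add, sum_add_distrib] at hsum
  rwa [hcol, hmul] at hsum

theorem sum_pow_mul_dist_barycentricIter_le (hB : IsPBarycenterMap B p K)
    (hA : A ∈ doublyStochastic ℝ ι) (x y : ι → X) (r u : ℕ) :
    ∑ i, ∑ j, (A ^ u) i j * dist (x i) (barycentricIter B hA y r j) ^ p +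
        1 / K ^ p * ∑ q ∈ range r, stepEnergy B hA y p q ≤
      ∑ i, ∑ j, (A ^ (u + r)) i j * dist (x i) (y j) ^ p := by
  induction r generalizing u with
  | zero => simp [barycentricIter]
  | succ r ih =>
    have h₁ := sum_mul_dist_barycentricIter_succ_le hB hA (pow_mem hA u) x y r
    have h₂ := ih (u + 1)
    rw [pow_succ] at h₂
    rw [sum_range_succ, mul_add, ← Nat.add_assoc, Nat.add_right_comm]
    linarith

/-- The energy inequality for the barycentric iteration started at `y`, seen from `x`. -/
theorem barycentricIter_energy_le (hB : IsPBarycenterMap B p K)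
    (hA : A ∈ doublyStochastic ℝ ι) (x y : ι → X) (r : ℕ) :
    ∑ i, dist (x i) (barycentricIter B hA y r i) ^ p +
        1 / K ^ p * ∑ q ∈ range r, stepEnergy B hA y p q ≤
      ∑ i, ∑ j, (A ^ r) i j * dist (x i) (y j) ^ p := by
  simpa [Matrix.one_apply] using sum_pow_mul_dist_barycentricIter_le hB hA x y r 0

end Iteration

/-! ### The triangle inequality for sums of `p`-th powers of distances -/

theorem add_five_rpow_le {p : ℝ} (hp : 1 ≤ p) {a b c d e : ℝ} (ha : 0 ≤ a) (hb : 0 ≤ b)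
    (hc : 0 ≤ c) (hd : 0 ≤ d) (he : 0 ≤ e) :
    (a + b + c + d + e) ^ p ≤ 5 ^ (p - 1) * (a ^ p + b ^ p + c ^ p + d ^ p + e ^ p) := by
  have h := Real.rpow_sum_le_const_mul_sum_rpow_of_nonneg (univ : Finset (Fin 5))
    (f := ![a, b, c, d, e]) hp (by intro i _; fin_cases i <;> simpa)
  simpa [Fin.sum_univ_five] using h

/-- The unweighted sum of `d(xᵢ, yⱼ)^p` is controlled along the chain
`xᵢ, zᵢ, wₗ, zₖ, xₖ, yⱼ`, where `l` is uniform and `k` is chosen according to the `j`-th column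
of `C`. -/
theorem sum_dist_rpow_le_of_doublyStochastic {ι X : Type*} [Fintype ι] [DecidableEq ι] [Nonempty ι]
    [MetricSpace X] {C : Matrix ι ι ℝ} (hC : C ∈ doublyStochastic ℝ ι) {p : ℝ} (hp : 1 ≤ p)
    (x y z w : ι → X) :
    ∑ i, ∑ j, dist (x i) (y j) ^ p ≤
      5 ^ (p - 1) * (Fintype.card ι * (∑ i, ∑ j, C i j * dist (x i) (y j) ^ p +
        2 * ∑ i, dist (x i) (z i) ^ p) + 2 * ∑ i, ∑ j, dist (z i) (w j) ^ p) := by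
  have hN : (0 : ℝ) < Fintype.card ι := by exact_mod_cast Fintype.card_pos
  have hpt (i j k l : ι) : dist (x i) (y j) ^ p ≤ 5 ^ (p - 1) *
      (dist (x i) (z i) ^ p + dist (z i) (w l) ^ p + dist (z k) (w l) ^ p +
        dist (x k) (z k) ^ p + dist (x k) (y j) ^ p) := by
    refine le_trans (Real.rpow_le_rpow dist_nonneg ?_ (by linarith))
      (add_five_rpow_le hp dist_nonneg dist_nonneg dist_nonneg dist_nonneg dist_nonneg)
    have h₁ := dist_triangle (x i) (z i) (y j)
    have h₂ := dist_triangle (z i) (w l) (y j)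
    have h₃ := dist_triangle (w l) (z k) (y j)
    have h₄ := dist_triangle (z k) (x k) (y j)
    rw [dist_comm (w l) (z k)] at h₃
    rw [dist_comm (z k) (x k)] at h₄
    linarith
  have hcol (j : ι) (a : ℝ) : ∑ k, C k j * a = a := by
    rw [← sum_mul, sum_col_of_mem_doublyStochastic hC, one_mul]
  have hrow (k : ι) (a : ℝ) : ∑ j, C k j * a = a := by
    rw [← sum_mul, sum_row_of_mem_doublyStochastic hC, one_mul]
  have hsum : ∑ i, ∑ _l : ι, ∑ j, ∑ k, C k j * dist (x i) (y j) ^ p ≤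
      ∑ i, ∑ l, ∑ j, ∑ k, C k j * (5 ^ (p - 1) *
        (dist (x i) (z i) ^ p + dist (z i) (w l) ^ p + dist (z k) (w l) ^ p +
          dist (x k) (z k) ^ p + dist (x k) (y j) ^ p)) := by
    gcongr with i _ l _ j _ k _
    · exact nonneg_of_mem_doublyStochastic hC
    · exact hpt i j k l
  have e₁ (f : ι → ℝ) : ∑ j, ∑ k, C k j * f k = ∑ k, f k := by
    rw [sum_comm]
    exact sum_congr rfl fun k _ => hrow k _
  have e₂ : ∑ j, ∑ k, C k j * dist (x k) (y j) ^ p = ∑ i, ∑ j, C i j * dist (x i) (y j) ^ p :=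
    sum_comm
  have e₃ : ∑ l, ∑ k, dist (z k) (w l) ^ p = ∑ k, ∑ l, dist (z k) (w l) ^ p := sum_comm
  simp only [mul_left_comm (C _ _), mul_add, sum_add_distrib, ← mul_sum, hcol, e₁, e₂, e₃,
    sum_const, card_univ, nsmul_eq_mul] at hsum
  rw [← mul_le_mul_iff_right₀ hN]
  linarith

/-! ### The spectral gap of the Cesàro averages -/

theorem IsSymmStochastic.mem_doublyStochastic {n : ℕ} {A : Matrix (Fin n) (Fin n) ℝ}
    (hA : IsSymmStochastic A) : A ∈ doublyStochastic ℝ (Fin n) := by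
  obtain ⟨hs, h0, h1⟩ := hA
  refine mem_doublyStochastic_iff_sum.2 ⟨h0, h1, fun j => ?_⟩
  rw [← h1 j]
  exact sum_congr rfl fun i _ => hs.apply j i

theorem sum_cesaro_mul {n t : ℕ} (A : Matrix (Fin n) (Fin n) ℝ) (f : Fin n → Fin n → ℝ) :
    ∑ i, ∑ j, cesaro A t i j * f i j =
      1 / (t : ℝ) * ∑ s ∈ range t, ∑ i, ∑ j, (A ^ (s + 1)) i j * f i j := by
  have hIcc : ∑ s ∈ Icc 1 t, A ^ s = ∑ s ∈ range t, A ^ (s + 1) := by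
    rw [range_eq_Ico, sum_Ico_add' (fun s => A ^ s) 0 t 1]
    rfl
  simp only [cesaro, hIcc, Matrix.smul_apply, Matrix.sum_apply, smul_eq_mul, mul_assoc, sum_mul,
    ← mul_sum]
  congr 1
  exact (sum_congr rfl fun i _ => sum_comm).trans sum_comm

theorem cesaro_mem_doublyStochastic {n t : ℕ} (ht : 1 ≤ t) {A : Matrix (Fin n) (Fin n) ℝ}
    (hA : A ∈ doublyStochastic ℝ (Fin n)) : cesaro A t ∈ doublyStochastic ℝ (Fin n) := by
  have ht' : (t : ℝ) ≠ 0 := by positivity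
  rw [cesaro, smul_sum]
  refine convex_doublyStochastic.sum_mem (fun _ _ => by positivity) ?_ fun s _ => pow_mem hA s
  simp [ht']

theorem sq_le_two_mul_sum_range_succ (t : ℕ) :
    (t : ℝ) ^ 2 ≤ 2 * ∑ s ∈ range t, ((s : ℝ) + 1) := by
  induction t with
  | zero => simp
  | succ t ih => rw [sum_range_succ]; push_cast; nlinarith

/-- The decay of the Poincaré constant, for a finite admissible `γ`. -/
theorem cesaro_poincare {X : Type*} [MetricSpace X] {B : ProbMeas X → X} {p K γ : ℝ} (hp : 1 ≤ p)
    (hK : 1 ≤ K) (hγ : 0 ≤ γ) (hB : IsPBarycenterMap B p K) {n t : ℕ} (hn : 1 ≤ n) (ht : 1 ≤ t)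
    {A : Matrix (Fin n) (Fin n) ℝ} (hA : A ∈ doublyStochastic ℝ (Fin n))
    (h : ∀ x y : Fin n → X, 1 / (n : ℝ) ^ 2 * ∑ i, ∑ j, dist (x i) (y j) ^ p ≤
      γ / n * ∑ i, ∑ j, A i j * dist (x i) (y j) ^ p) (x y : Fin n → X) :
    1 / (n : ℝ) ^ 2 * ∑ i, ∑ j, dist (x i) (y j) ^ p ≤
      ((10 * K) ^ p * max 1 (γ / t)) / n *
        ∑ i, ∑ j, cesaro A t i j * dist (x i) (y j) ^ p := by
  have : NeZero n := ⟨by omega⟩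
  have hn' : (0 : ℝ) < n := by positivity
  have ht' : (0 : ℝ) < t := by positivity
  have hKp : 1 ≤ K ^ p := Real.one_le_rpow hK (by linarith)
  set F := ∑ i, ∑ j, cesaro A t i j * dist (x i) (y j) ^ p with hF
  set S := ∑ i, ∑ j, dist (x i) (y j) ^ p with hS
  set z := barycentricIter B hA y with hz
  set a := stepEnergy B hA y p with ha
  set b : ℕ → ℝ := fun r => ∑ i, dist (x i) (z (r + 1) i) ^ p with hb
  set E : ℕ → ℝ := fun s => ∑ i, ∑ j, (A ^ (s + 1)) i j * dist (x i) (y j) ^ p with hE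
  have hFE : ∑ s ∈ range t, E s = t * F := by
    rw [hF, sum_cesaro_mul]
    rw [← mul_assoc, mul_one_div_cancel ht'.ne', one_mul]
  have ha0 (r : ℕ) : 0 ≤ a r := stepEnergy_nonneg hA y r
  have hb0 (r : ℕ) : 0 ≤ b r := sum_nonneg fun _ _ => Real.rpow_nonneg dist_nonneg _
  have henergy (s : ℕ) : b s + 1 / K ^ p * ∑ q ∈ range (s + 1), a q ≤ E s :=
    barycentricIter_energy_le hB hA x y (s + 1)
  have hbE (s : ℕ) : b s ≤ E s := by
    have h₁ : 0 ≤ 1 / K ^ p * ∑ q ∈ range (s + 1), a q :=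
      mul_nonneg (by positivity) (sum_nonneg fun q _ => ha0 q)
    linarith [henergy s]
  have haE (s : ℕ) : ∑ q ∈ range (s + 1), a q ≤ K ^ p * E s := by
    rw [← div_le_iff₀' (by positivity), div_eq_inv_mul, ← one_div]
    linarith [henergy s, hb0 s]
  have hF0 : 0 ≤ F := by
    have : 0 ≤ t * F := hFE ▸ sum_nonneg fun s _ => (hb0 s).trans (hbE s)
    exact nonneg_of_mul_nonneg_right this ht'
  have hstep (r : ℕ) : S ≤ 5 ^ (p - 1) * n * (F + 2 * b r + 2 * γ * a r) := by
    have h₁ := sum_dist_rpow_le_of_doublyStochastic (cesaro_mem_doublyStochastic ht hA) hp x y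
      (z (r + 1)) (z r)
    have h₂ : ∑ i, ∑ j, dist (z (r + 1) i) (z r j) ^ p ≤ n * γ * a r := by
      have h₃ := mul_le_mul_of_nonneg_left (h (z (r + 1)) (z r)) (by positivity : 0 ≤ (n : ℝ) ^ 2)
      rw [← mul_assoc, mul_one_div_cancel (by positivity), one_mul] at h₃
      refine h₃.trans_eq ?_
      rw [ha, stepEnergy]
      field_simp
      rfl
    rw [Fintype.card_fin] at h₁
    refine h₁.trans ?_
    rw [mul_assoc]
    gcongr
    simp only [hb]
    linarith
  -- Sum over all pairs `r ≤ s < t`; there are at least `t² / 2` and at most `t²` of them.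
  have hb_sum (s : ℕ) (hs : s ∈ range t) : ∑ r ∈ range (s + 1), b r ≤ t * F := by
    rw [← hFE]
    have hsub : range (s + 1) ⊆ range t := range_subset_range.2 (mem_range.1 hs)
    exact (sum_le_sum_of_subset_of_nonneg hsub fun r _ _ => hb0 r).trans
      (sum_le_sum fun r _ => hbE r)
  have hs_sum (s : ℕ) (hs : s ∈ range t) : ((s : ℝ) + 1) * S ≤
      5 ^ (p - 1) * n * (3 * (t * F) + 2 * γ * K ^ p * E s) := by
    calc ((s : ℝ) + 1) * S = ∑ r ∈ range (s + 1), S := by simp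
      _ ≤ ∑ r ∈ range (s + 1), 5 ^ (p - 1) * n * (F + 2 * b r + 2 * γ * a r) :=
        sum_le_sum fun r _ => hstep r
      _ = 5 ^ (p - 1) * n * (((s : ℝ) + 1) * F + 2 * ∑ r ∈ range (s + 1), b r +
          2 * γ * ∑ r ∈ range (s + 1), a r) := by
        rw [← mul_sum, sum_add_distrib, sum_add_distrib, ← mul_sum, ← mul_sum]
        simp
      _ ≤ _ := by
        have h₁ : ((s : ℝ) + 1) * F ≤ t * F := by
          gcongr
          exact_mod_cast mem_range.1 hs
        have h₂ := mul_le_mul_of_nonneg_left (haE s) (by positivity : 0 ≤ 2 * γ)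
        refine mul_le_mul_of_nonneg_left ?_ (by positivity)
        linarith [hb_sum s hs]
  have htotal : (t : ℝ) ^ 2 * S ≤
      2 * (5 ^ (p - 1) * n * (3 * (t * (t * F)) + 2 * γ * K ^ p * (t * F))) := by
    have hS0 : 0 ≤ S :=
      sum_nonneg fun _ _ => sum_nonneg fun _ _ => Real.rpow_nonneg dist_nonneg _
    calc (t : ℝ) ^ 2 * S ≤ (2 * ∑ s ∈ range t, ((s : ℝ) + 1)) * S := by
          gcongr
          exact sq_le_two_mul_sum_range_succ t
      _ = 2 * ∑ s ∈ range t, ((s : ℝ) + 1) * S := by rw [mul_assoc, sum_mul]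
      _ ≤ 2 * ∑ s ∈ range t, 5 ^ (p - 1) * n * (3 * (t * F) + 2 * γ * K ^ p * E s) := by
          exact mul_le_mul_of_nonneg_left (sum_le_sum hs_sum) (by norm_num)
      _ = _ := by
          simp only [← mul_sum, sum_add_distrib, hFE, sum_const, card_range, nsmul_eq_mul]
  set M := max 1 (γ / t) with hM
  have hM1 : 1 ≤ M := le_max_left _ _
  have hγM : γ ≤ t * M := by
    rw [← div_le_iff₀' ht']
    exact le_max_right _ _
  -- The two summands of `htotal` contribute `2 * (3 + 2) * 5 ^ (p - 1) = 2 * 5 ^ p ≤ 10 ^ p`.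
  have h10 : 10 * 5 ^ (p - 1) * K ^ p ≤ (10 * K) ^ p := by
    rw [Real.mul_rpow (by norm_num) (by linarith)]
    gcongr
    have h₁ : (10 : ℝ) ^ p = 2 ^ p * 5 ^ p := by
      rw [← Real.mul_rpow (by norm_num) (by norm_num)]
      norm_num
    have h₂ : (2 : ℝ) ≤ 2 ^ p := Real.self_le_rpow_of_one_le (by norm_num) hp
    have h₃ : (5 : ℝ) * 5 ^ (p - 1) = 5 ^ p := by
      rw [Real.rpow_sub_one (by norm_num)]
      ring
    rw [h₁, ← h₃]
    have : (0 : ℝ) ≤ 5 * 5 ^ (p - 1) := by positivity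
    nlinarith
  have hSn : S ≤ n * ((10 * K) ^ p * M * F) := by
    have h₁ : 3 * (t * (t * F)) + 2 * γ * K ^ p * (t * F) ≤ (t : ℝ) ^ 2 * (5 * (K ^ p * M) * F) := by
      have h₂ : 1 ≤ K ^ p * M := one_le_mul_of_one_le_of_one_le hKp hM1
      calc 3 * (t * (t * F)) + 2 * γ * K ^ p * (t * F)
          ≤ 3 * (K ^ p * M) * (t * (t * F)) + 2 * (t * M) * K ^ p * (t * F) := by
            gcongr
            linarith
        _ = _ := by ring
    have h₃ : (t : ℝ) ^ 2 * S ≤ (t : ℝ) ^ 2 * (n * (10 * 5 ^ (p - 1) * K ^ p * M * F)) :=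
      htotal.trans <| by
        calc _ ≤ 2 * (5 ^ (p - 1) * n * ((t : ℝ) ^ 2 * (5 * (K ^ p * M) * F))) := by gcongr
          _ = _ := by ring
    refine (le_of_mul_le_mul_left h₃ (by positivity)).trans ?_
    gcongr
  calc 1 / (n : ℝ) ^ 2 * S ≤ 1 / (n : ℝ) ^ 2 * (n * ((10 * K) ^ p * M * F)) := by gcongr
    _ = _ := by field_simp

/-- The bound on `γ₊` with a constant independent of the Wasserstein Lipschitz constant. -/
theorem gammaPlus_cesaro_le {X : Type*} [MetricSpace X] {B : ProbMeas X → X} {p K : ℝ}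
    (hp : 1 ≤ p) (hK : 1 ≤ K) (hB : IsPBarycenterMap B p K) {n t : ℕ} (hn : 1 ≤ n) (ht : 1 ≤ t)
    {A : Matrix (Fin n) (Fin n) ℝ} (hA : A ∈ doublyStochastic ℝ (Fin n)) :
    gammaPlus X (cesaro A t) p ≤
      ENNReal.ofReal ((10 * K) ^ p) * max 1 (gammaPlus X A p / (t : ℝ≥0∞)) := by
  have hn' : (0 : ℝ) < n := by positivity
  have ht' : (0 : ℝ) < t := by positivity
  have hc : 0 < (10 * K) ^ p := by positivity
  have hdiv (γ : ℝ) (b : ℝ) (hγ : 0 ≤ γ) :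
      ENNReal.ofReal γ / (n : ℝ≥0∞) * ENNReal.ofReal b = ENNReal.ofReal (γ / n * b) := by
    rw [ENNReal.ofReal_mul (by positivity), ENNReal.ofReal_div_of_pos hn', ENNReal.ofReal_natCast]
  have hnonneg {D : Matrix (Fin n) (Fin n) ℝ} (hD : D ∈ doublyStochastic ℝ (Fin n))
      (x y : Fin n → X) : 0 ≤ ∑ i, ∑ j, D i j * dist (x i) (y j) ^ p :=
    sum_nonneg fun _ _ => sum_nonneg fun _ _ =>
      mul_nonneg (nonneg_of_mem_doublyStochastic hD) (Real.rpow_nonneg dist_nonneg _)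
  -- The right-hand side depends on `γ₊(A, d^p)` monotonically and continuously, so it suffices to
  -- bound the left-hand side for each admissible `γ`.
  let f : ℝ≥0∞ → ℝ≥0∞ := fun γ => ENNReal.ofReal ((10 * K) ^ p) * max 1 (γ / (t : ℝ≥0∞))
  have hf_mono : Monotone f := fun γ γ' hγ => by
    dsimp only [f]
    gcongr
  have hf_cont : Continuous f :=
    (ENNReal.continuous_const_mul ENNReal.ofReal_ne_top).comp
      (continuous_const.max (ENNReal.continuous_div_const _ (by positivity)))
  have hf_top : f ⊤ = ⊤ := by
    simp [f, ENNReal.top_div, ENNReal.mul_top, hc]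
  change _ ≤ f (sInf _)
  rw [hf_mono.map_sInf_of_continuousAt hf_cont.continuousAt hf_top]
  refine le_sInf ?_
  rintro _ ⟨γ, ⟨-, hγ⟩, rfl⟩
  obtain rfl | hγ_top := eq_or_ne γ ⊤
  · simp [hf_top]
  lift γ to NNReal using hγ_top
  have hfγ : f γ = ENNReal.ofReal ((10 * K) ^ p * max 1 ((γ : ℝ) / t)) := by
    dsimp only [f]
    rw [ENNReal.ofReal_mul hc.le, ENNReal.ofReal_max, ENNReal.ofReal_one,
      ENNReal.ofReal_div_of_pos ht', ENNReal.ofReal_natCast, ENNReal.ofReal_coe_nnreal]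
  refine sInf_le ⟨?_, fun x y => ?_⟩
  · rw [hfγ]
    exact ENNReal.ofReal_pos.2 (mul_pos hc (lt_max_of_lt_left one_pos))
  · rw [hfγ, hdiv _ _ (by positivity)]
    refine ENNReal.ofReal_le_ofReal
      (cesaro_poincare hp hK γ.coe_nonneg hB hn ht hA (fun u v => ?_) x y)
    have h := hγ u v
    rw [← ENNReal.ofReal_coe_nnreal, hdiv _ _ γ.coe_nonneg] at h
    exact (ENNReal.ofReal_le_ofReal_iff (mul_nonneg (by positivity) (hnonneg hA u v))).1 h

end BarycentricCalculus

theorem theorem1p5 :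
    ∃ c : ℝ, 1 < c ∧
      ∀ (p K Γ : ℝ), 1 ≤ p → 1 ≤ K → 1 ≤ Γ →
      ∀ (X : Type*) [MetricSpace X],
        (∃ B : BarycentricCalculus.ProbMeas X → X,
          BarycentricCalculus.IsWpBarycenterMap B p Γ ∧
          BarycentricCalculus.IsPBarycenterMap B p K) →
        ∀ (n t : ℕ), 1 ≤ n → 1 ≤ t →
        ∀ A : Matrix (Fin n) (Fin n) ℝ, BarycentricCalculus.IsSymmStochastic A →
          BarycentricCalculus.gammaPlus X (BarycentricCalculus.cesaro A t) p ≤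
            ENNReal.ofReal ((c * Γ * K) ^ p) *
              max 1 (BarycentricCalculus.gammaPlus X A p / (t : ENNReal)) := by
  refine ⟨10, by norm_num, ?_⟩
  rintro p K Γ hp hK hΓ X _ ⟨B, -, hB⟩ n t hn ht A hA
  refine (BarycentricCalculus.gammaPlus_cesaro_le hp hK hB hn ht hA.mem_doublyStochastic).trans ?_
  gcongr
  linarith
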